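/- Let $\mathbb K$ be a field of characteristic zero with an automorphism $\tau$ and a derivation $\partial$ commuting with $\tau$, and assume that the field of constants $C=\{c\in\mathbb K:\tau(c)=c\}$ is algebraically closed. An element $y$ of a $\mathbb K$-algebra to which $\tau$ and $\partial$ extend (as a ring endomorphism and a derivation that commute) is called differentially algebraic over $\mathbb K$ if $P(y,\partial y,\dots,\partial^n y)=0$ for some $n\ge 0$ and some nonzero polynomial $P$ over $\mathbb K$ in $n+1$ variables, and differentially transcendental over $\mathbb K$ otherwise. Let $a,f\in\mathbb K$ with $a\neq 0,1$ and $f\neq 0$. Let $F/\mathbb K$ be a field extension to which $\tau$ and $\partial$ extend, preserving the commutation, and let $w\in F\setminus\mathbb K$ satisfy $\tau(w)=aw+f$. We say that $\partial(a)/a$ has a telescoper if there are $n\ge 0$, $\alpha_0,\dots,\alpha_n\in C$, not all zero, and $g\in\mathbb K$ such that $$\sum_{i=0}^n\alpha_i\,\partial^i\!\left(\frac{\partial(a)}{a}\right)=\tau(g)-g .$$ 1. Let $F_a$ be any nonzero $\mathbb K$-algebra without nonzero nilpotent elements in which every element is a zero divisor or invertible, equipped with extensions of $\tau$ and $\partial$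 that commute and such that $F_a^{\tau}=C$, and let $z\in F_a$ be an invertible element with $\tau(z)=az$. If $z$ is differentially transcendental over $\mathbb K$, then $w$ is differentially transcendental over $\mathbb K$; in other words, if $w$ is differentially algebraic over $\mathbb K$, then so is $z$. Moreover, $z$ is differentially transcendental over $\mathbb K$ if and only if $\partial(a)/a$ has no telescoper. 2. If $\partial(a)/a$ has no telescoper, then $w$ is differentially transcendental over $\mathbb K$. -/

import Mathlib

/-- A difference-differential structure on a commutative ring: a ring endomorphism `τ` and a
derivation `δ` that commute. -/
structure DiffDiffStructure (R : Type*) [CommRing R] where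
  τ : R →+* R
  δ : Derivation ℤ R R
  comm : ∀ x : R, δ (τ x) = τ (δ x)

namespace DiffDiffStructure

/-- The field of constants of a difference-differential field: the elements fixed by `τ`. -/
def constants {K : Type*} [Field K] (D : DiffDiffStructure K) : Subfield K :=
  D.τ.eqLocusField (RingHom.id K)

/-- The structure `E` on the `K`-algebra `A` extends the structure `D` on `K`. -/
structure Extends {K A : Type*} [CommRing K] [CommRing A] [Algebra K A]
    (D : DiffDiffStructure K) (E : DiffDiffStructure A) : Prop where
  τ_algebraMap : ∀ x : K, E.τ (algebraMap K A x) = algebraMap K A (D.τ x)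
  δ_algebraMap : ∀ x : K, E.δ (algebraMap K A x) = algebraMap K A (D.δ x)

/-- `A` is a `K`-algebra without nilpotent elements in which every element is a zero divisor or
invertible; its structure extends that of `K`, and its `τ`-invariant elements are
exactly the constants of `K`. -/
structure IsSolutionAlgebra {K A : Type*} [Field K] [CommRing A] [Algebra K A]
    (D : DiffDiffStructure K) (E : DiffDiffStructure A) : Prop where
  nontrivial : Nontrivial A
  isReduced : IsReduced A
  zeroDivisor_or_isUnit : ∀ x : A, (∃ y : A, y ≠ 0 ∧ x * y = 0) ∨ IsUnit x
  ext : D.Extends E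
  constants_eq : ∀ x : A, E.τ x = x ↔ ∃ c ∈ D.constants, algebraMap K A c = x

/-- `x` is differentially algebraic over `K`: it satisfies an algebraic differential equation
`P (x, δ x, δ² x, …) = 0` for a nonzero polynomial `P` with coefficients in `K`. -/
def DifferentiallyAlgebraic (K : Type*) {A : Type*} [Field K] [CommRing A] [Algebra K A]
    (E : DiffDiffStructure A) (x : A) : Prop :=
  ∃ P : MvPolynomial ℕ K, P ≠ 0 ∧ MvPolynomial.aeval (fun i : ℕ => E.δ^[i] x) P = 0

/-- `x` is differentially transcendental over `K`. -/
def DifferentiallyTranscendental (K : Type*) {A : Type*} [Field K] [CommRing A] [Algebra K A]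
    (E : DiffDiffStructure A) (x : A) : Prop :=
  ¬ E.DifferentiallyAlgebraic K x

/-- `b` admits a telescoper: `α₀ b + α₁ δ b + ⋯ + αₙ δⁿ b = τ g - g` for some `n`, some constants
`α₀, …, αₙ`, not all zero, and some `g` in `K`. -/
def HasTelescoper {K : Type*} [Field K] (D : DiffDiffStructure K) (b : K) : Prop :=
  ∃ (n : ℕ) (α : Fin (n + 1) → D.constants) (g : K),
    (∃ i, α i ≠ 0) ∧ ∑ i : Fin (n + 1), (α i : K) * D.δ^[(i : ℕ)] b = D.τ g - g

end DiffDiffStructure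

/-! Put `b = δ a / a` and let σ be `shift 1 b`, i.e. `X 0 ↦ X 0 + b` on differential polynomials.
Without a telescoper, every σ-semi-invariant is a constant polynomial (`eq_C_of_shift_eq_smul`):
partial derivatives commute with σ, so induction reduces to degree one, where coefficients can be
read off.

To reach this from `τ w = a w + f`, substitute for `X 0` a variable `t` with `t' = X 0 * t`
(`expSubst`). The coefficient of `t ^ d` in a relation of degree at most `d` determines its
degree-`d` form, and `w ↦ a w + f` acts on it as `a ^ d` times σ (`coeff_expSubst_shift`). For
minimal `d` these coefficients form a σ-stable space, which contains `1`; so there is a relation `X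
0 ^ d + P` with `P` of lower degree, semi-invariant by minimality (`exists_minimal_relation`).

Its coefficient of `t ^ (d - 1)` yields `u` in `K` with `τ u = a u + f`. Then `w - u` solves the
homogeneous equation, for which `P` must vanish, so `w - u` is nilpotent and `w = u`, a
contradiction. The same nilpotency excludes a differentially algebraic unit `z`.

Conversely, a telescoper gives a linear differential equation for `y = z' / z`, hence an algebraic
one for `z`. -/

namespace DiffDiffStructure

open MvPolynomial

/-! ### Differential polynomials, the shift and evaluation -/

/-- The derivation of a polynomial ring that extends a derivation of the coefficients and takes
prescribed values on the variables. -/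
noncomputable def extendDerivation {K : Type*} [CommRing K] (d : Derivation ℤ K K)
    (v : ℕ → MvPolynomial ℕ K) : Derivation ℤ (MvPolynomial ℕ K) (MvPolynomial ℕ K) :=
  let c : K →+* DualNumber (MvPolynomial ℕ K) :=
    { toFun := fun x => TrivSqZeroExt.inl (C x) + TrivSqZeroExt.inr (C (d x))
      map_one' := by ext <;> simp
      map_zero' := by ext <;> simp
      map_mul' := fun x y => by ext <;> simp [mul_comm]
      map_add' := fun x y => by ext <;> simp }
  let g : MvPolynomial ℕ K →+* DualNumber (MvPolynomial ℕ K) :=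
    eval₂Hom c fun i => TrivSqZeroExt.inl (X i) + TrivSqZeroExt.inr (v i)
  have hg : ∀ P, (g P).fst = P := fun P => by
    induction P using MvPolynomial.induction_on with
    | C x => simp [g, c]
    | add p q hp hq => simp [hp, hq]
    | mul_X p i hp => simp [hp]; simp [g]
  Derivation.mk' ((AddMonoidHom.mk' (fun P => (g P).snd) fun P Q => by simp).toIntLinearMap)
    fun P Q => by
      simp only [AddMonoidHom.coe_toIntLinearMap, AddMonoidHom.mk'_apply, map_mul,
        DualNumber.snd_mul, hg, smul_eq_mul]
      rw [mul_comm (g P).snd Q]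

@[simp]
theorem extendDerivation_C {K : Type*} [CommRing K] (d : Derivation ℤ K K)
    (v : ℕ → MvPolynomial ℕ K) (x : K) : extendDerivation d v (C x) = C (d x) := by
  simp [extendDerivation]

@[simp]
theorem extendDerivation_X {K : Type*} [CommRing K] (d : Derivation ℤ K K)
    (v : ℕ → MvPolynomial ℕ K) (i : ℕ) : extendDerivation d v (X i) = v i := by
  simp [extendDerivation]

/-- A ring homomorphism out of a polynomial ring commutes with derivations as soon as it does so
on the coefficients and on the variables. -/
theorem map_derivation_of_generators {K B : Type*} [CommRing K] [CommRing B]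
    (d : Derivation ℤ (MvPolynomial ℕ K) (MvPolynomial ℕ K)) (e : B → B)
    (hadd : ∀ x y, e (x + y) = e x + e y) (hmul : ∀ x y, e (x * y) = x * e y + y * e x)
    (g : MvPolynomial ℕ K →+* B) (hC : ∀ x, g (d (C x)) = e (g (C x)))
    (hX : ∀ i, g (d (X i)) = e (g (X i))) (P : MvPolynomial ℕ K) : g (d P) = e (g P) := by
  induction P using MvPolynomial.induction_on with
  | C x => exact hC x
  | add p q hp hq => rw [map_add, map_add, map_add, hp, hq, hadd]
  | mul_X p i hp => simp [hp, hX, hmul]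

theorem map_iterate {A B F G : Type*} {φ : A → B} {d : F} {e : G} [FunLike F A A] [FunLike G B B]
    (h : ∀ x, φ (d x) = e (φ x)) (n : ℕ) (x : A) : φ (d^[n] x) = e^[n] (φ x) :=
  Function.Semiconj.iterate_right (f := φ) (ga := d) (gb := e) h n x

section

variable {K : Type*} [Field K] (D : DiffDiffStructure K)

/-- The derivation of the ring of differential polynomials `K{X₀}`, with `X i` standing for the
`i`-th derivative of `X 0`. -/
noncomputable def dd : Derivation ℤ (MvPolynomial ℕ K) (MvPolynomial ℕ K) :=
  extendDerivation D.δ fun i => X (i + 1)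

@[simp] theorem dd_C (x : K) : D.dd (C x) = C (D.δ x) := by simp [dd]

@[simp] theorem dd_X (i : ℕ) : D.dd (X i) = X (i + 1) := by simp [dd]

theorem dd_iterate_X_zero (i : ℕ) : D.dd^[i] (X 0) = X i := by
  induction i with
  | zero => rfl
  | succ n ih => rw [Function.iterate_succ_apply', ih, dd_X]

theorem dd_iterate_C (i : ℕ) (x : K) : D.dd^[i] (C x) = C (D.δ^[i] x) :=
  (map_iterate (φ := (C : K →+* MvPolynomial ℕ K)) (fun x => (D.dd_C x).symm) i x).symm

/-- The `τ`-semilinear differential substitution `X 0 ↦ a X 0 + f`. -/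
noncomputable def shift (a f : K) : MvPolynomial ℕ K →+* MvPolynomial ℕ K :=
  eval₂Hom (C.comp D.τ) fun i => D.dd^[i] (C a * X 0 + C f)

@[simp] theorem shift_C (a f x : K) : D.shift a f (C x) = C (D.τ x) := by simp [shift]

theorem shift_X (a f : K) (i : ℕ) : D.shift a f (X i) = D.dd^[i] (C a * X 0 + C f) := by
  simp [shift]

theorem shift_one_X (b : K) (i : ℕ) : D.shift 1 b (X i) = X i + C (D.δ^[i] b) := by
  rw [shift_X, map_one, one_mul, iterate_map_add, dd_iterate_X_zero, dd_iterate_C]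

theorem shift_dd (a f : K) (P : MvPolynomial ℕ K) :
    D.shift a f (D.dd P) = D.dd (D.shift a f P) :=
  map_derivation_of_generators _ _ (map_add _) D.dd.leibniz _
    (fun x => by rw [dd_C, shift_C, shift_C, dd_C, D.comm])
    (fun i => by rw [dd_X, shift_X, shift_X, Function.iterate_succ_apply']) P

/-- Evaluation of differential polynomials. -/
noncomputable def evalDiff (K : Type*) [Field K] {A : Type*} [CommRing A] [Algebra K A]
    (E : DiffDiffStructure A) (w : A) : MvPolynomial ℕ K →ₐ[K] A :=
  aeval fun i : ℕ => E.δ^[i] w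

variable {A : Type*} [CommRing A] [Algebra K A] {D} {E : DiffDiffStructure A}

theorem evalDiff_C (w : A) (x : K) : E.evalDiff K w (C x) = algebraMap K A x := by
  simp [evalDiff]

theorem evalDiff_X (w : A) (i : ℕ) : E.evalDiff K w (X i) = E.δ^[i] w := by
  simp [evalDiff]

theorem evalDiff_dd (hE : D.Extends E) (w : A) (P : MvPolynomial ℕ K) :
    E.evalDiff K w (D.dd P) = E.δ (E.evalDiff K w P) :=
  map_derivation_of_generators D.dd E.δ (map_add _) E.δ.leibniz (E.evalDiff K w).toRingHom
    (fun x => by simp [evalDiff, hE.δ_algebraMap])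
    (fun i => by
      rw [dd_X]
      exact (evalDiff_X w _).trans ((Function.iterate_succ_apply' _ _ _).trans
        (congrArg E.δ (evalDiff_X w _).symm))) P

theorem evalDiff_shift (hE : D.Extends E) {w : A} {a f : K}
    (hw : E.τ w = algebraMap K A a * w + algebraMap K A f) (P : MvPolynomial ℕ K) :
    E.evalDiff K w (D.shift a f P) = E.τ (E.evalDiff K w P) := by
  induction P using MvPolynomial.induction_on with
  | C x => simp [evalDiff, hE.τ_algebraMap]
  | add p q hp hq => simp [hp, hq]
  | mul_X p i hp =>
    rw [map_mul, map_mul, hp, map_mul, map_mul, shift_X, evalDiff_X,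
      map_iterate (φ := E.evalDiff K w) (evalDiff_dd hE w),
      map_iterate (φ := E.τ) (d := E.δ) (e := E.δ) (fun x => (E.comm x).symm), hw]
    simp [evalDiff]

end

/-! ### Semi-invariants of the additive shift -/

section

variable {K : Type*} [Field K] {D : DiffDiffStructure K}

/-- Take logarithmic derivatives: `m * (δ a / a) = τ g - g` with `g = δ c / c`, a telescoper of
order zero since `m ≠ 0` in characteristic zero. -/
theorem hasTelescoper_of_eq_pow_mul [CharZero K] {a c : K} (ha : a ≠ 0) (hc : c ≠ 0) {m : ℕ}
    (hm : m ≠ 0) (h : D.τ c = a ^ m * c) : D.HasTelescoper (D.δ a / a) := by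
  refine ⟨0, fun _ => (m : D.constants), D.δ c / c, ⟨0, ?_⟩, ?_⟩
  · intro h0
    have := congrArg (Subtype.val) h0
    simp [hm] at this
  · have h1 : D.τ (D.δ c) = m * a ^ (m - 1) * D.δ a * c + a ^ m * D.δ c := by
      rw [← D.comm, h, D.δ.leibniz, D.δ.leibniz_pow]
      simp
      ring
    obtain ⟨k, rfl⟩ := Nat.exists_eq_succ_of_ne_zero hm
    rw [map_div₀, h1, h]
    simp
    field_simp
    ring

/-- Each `X i` is merely translated by an element of `K`. This makes induction on the degree
possible. -/
theorem pderiv_shift_one (b : K) (i : ℕ) (P : MvPolynomial ℕ K) :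
    pderiv i (D.shift 1 b P) = D.shift 1 b (pderiv i P) := by
  induction P using MvPolynomial.induction_on with
  | C x => simp
  | add p q hp hq => simp [hp, hq]
  | mul_X p j hp =>
    rw [map_mul, Derivation.leibniz, Derivation.leibniz, hp, shift_one_X]
    by_cases h : i = j
    · subst h
      simp [shift_one_X]
    · simp [shift_one_X, pderiv_X_of_ne (Ne.symm h)]

theorem exists_single_eq_of_degree_eq_one {m : ℕ →₀ ℕ} (hm : m.degree = 1) :
    ∃ i, Finsupp.single i 1 = m := by
  have hm0 : m ≠ 0 := by rintro rfl; simp at hm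
  obtain ⟨i, hi⟩ := Finsupp.ne_iff.mp hm0
  have hle : Finsupp.single i 1 ≤ m := by
    rw [Finsupp.single_le_iff]
    exact Nat.one_le_iff_ne_zero.mpr hi
  have h := tsub_add_cancel_of_le hle
  have h1 := congrArg Finsupp.degree h
  rw [map_add, hm, Finsupp.degree_single, Nat.add_eq_right, Finsupp.degree_eq_zero_iff] at h1
  rw [h1, zero_add] at h
  exact ⟨i, h⟩

theorem coeff_eq_zero_of_pderiv_eq_C [CharZero K] {Q : MvPolynomial ℕ K}
    (h : ∀ i, pderiv i Q = C (coeff 0 (pderiv i Q))) {m : ℕ →₀ ℕ} (hm : 1 < m.degree) :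
    coeff m Q = 0 := by
  have hm0 : m ≠ 0 := by rintro rfl; simp at hm
  obtain ⟨i, hi⟩ := Finsupp.ne_iff.mp hm0
  have hle : Finsupp.single i 1 ≤ m := by
    rw [Finsupp.single_le_iff]
    exact Nat.one_le_iff_ne_zero.mpr hi
  have hadd := tsub_add_cancel_of_le hle
  have h1 := coeff_pderiv (i := i) Q (m - Finsupp.single i 1)
  rw [hadd, h, coeff_C, if_neg] at h1
  · have : (((m - Finsupp.single i 1 : ℕ →₀ ℕ) i : K) + 1) ≠ 0 := by
      exact_mod_cast Nat.succ_ne_zero ((m - Finsupp.single i 1 : ℕ →₀ ℕ) i)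
    exact (mul_eq_zero.mp h1.symm).resolve_right this
  · intro h2
    rw [← h2, zero_add] at hadd
    rw [← hadd] at hm
    simp at hm

theorem eq_C_of_forall_pderiv_eq_zero [CharZero K] {Q : MvPolynomial ℕ K}
    (h : ∀ i, pderiv i Q = 0) : Q = C (coeff 0 Q) := by
  ext m
  rw [coeff_C]
  split_ifs with hm
  · rw [hm]
  obtain ⟨i, hi⟩ := Finsupp.ne_iff.mp (Ne.symm hm)
  have hle : Finsupp.single i 1 ≤ m := by
    rw [Finsupp.single_le_iff]
    exact Nat.one_le_iff_ne_zero.mpr hi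
  have h1 := coeff_pderiv (i := i) Q (m - Finsupp.single i 1)
  rw [tsub_add_cancel_of_le hle, h, coeff_zero] at h1
  have : (((m - Finsupp.single i 1 : ℕ →₀ ℕ) i : K) + 1) ≠ 0 := by
    exact_mod_cast Nat.succ_ne_zero ((m - Finsupp.single i 1 : ℕ →₀ ℕ) i)
  exact (mul_eq_zero.mp h1.symm).resolve_right this

theorem exists_eq_add_sum {Q : MvPolynomial ℕ K} (h : ∀ m : ℕ →₀ ℕ, 1 < m.degree → coeff m Q = 0) :
    ∃ n, Q = C (coeff 0 Q) +
      ∑ i ∈ Finset.range (n + 1), C (coeff (Finsupp.single i 1) Q) * X i := by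
  refine ⟨Q.vars.sup id, ?_⟩
  ext m
  rw [coeff_add, coeff_C, coeff_sum]
  simp only [coeff_C_mul, coeff_X]
  rcases Nat.lt_trichotomy m.degree 1 with hm | hm | hm
  · obtain rfl : m = 0 := (Finsupp.degree_eq_zero_iff m).mp (by omega)
    simp
  · obtain ⟨i, rfl⟩ : ∃ i, Finsupp.single i 1 = m :=
      exists_single_eq_of_degree_eq_one hm
    rw [if_neg (by simp [Finsupp.ext_iff]; exact ⟨i, by simp⟩), zero_add]
    simp only [Finsupp.single_left_inj one_ne_zero]
    simp only [mul_ite, mul_one, mul_zero, Finset.sum_ite_eq', Finset.mem_range]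
    split_ifs with hi
    · rfl
    · by_contra h0
      refine hi (Nat.lt_succ_of_le (Finset.le_sup (f := id) ?_))
      rw [mem_vars_iff_mem_support]
      exact ⟨_, mem_support_iff.mpr h0, by simp⟩
  · rw [h m hm, if_neg (by rintro rfl; simp at hm), zero_add]
    refine (Finset.sum_eq_zero fun i _ => ?_).symm
    rw [if_neg (by rintro rfl; simp at hm), mul_zero]

/-- For `Q = g + ∑ α i * X i`, comparing coefficients gives `τ (α i) = l * α i` and `τ g + ∑ τ (α i)
* δ^[i] b = l * g`. If some `α j ≠ 0`, the quotients `α i / α j` are constants, and together with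
`-g / α j` they form a telescoper. -/
theorem eq_C_of_shift_eq_smul_of_linear {b l : K} (hb : ¬ D.HasTelescoper b)
    {Q : MvPolynomial ℕ K} (hQ : D.shift 1 b Q = C l * Q)
    (h : ∀ m : ℕ →₀ ℕ, 1 < m.degree → coeff m Q = 0) : Q = C (coeff 0 Q) := by
  obtain ⟨n, hn⟩ := exists_eq_add_sum h
  set g := coeff 0 Q
  set α : ℕ → K := fun i => coeff (Finsupp.single i 1) Q with hα
  have e : C (D.τ g) + ∑ i ∈ Finset.range (n + 1), C (D.τ (α i)) * (X i + C (D.δ^[i] b)) =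
      C l * (C g + ∑ i ∈ Finset.range (n + 1), C (α i) * X i) := by
    rw [← hn, ← hQ, hn]
    simp [shift_one_X, hα]
  have e1 : ∀ i ∈ Finset.range (n + 1), D.τ (α i) = l * α i := fun i hi => by
    have := congrArg (coeff (Finsupp.single i 1)) e
    have h0 : (0 : ℕ →₀ ℕ) ≠ Finsupp.single i 1 := fun h => by
      simpa using congrArg Finsupp.degree h
    simpa only [coeff_add, coeff_sum, mul_add, Finset.sum_add_distrib, coeff_C_mul, coeff_X,
      ← C_mul, coeff_C, h0, if_false, Finsupp.single_left_inj one_ne_zero, mul_ite, mul_one,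
      mul_zero, Finset.sum_ite_eq', hi, if_true, zero_add, Finset.sum_const_zero, add_zero]
      using this
  have e0 : D.τ g + ∑ i ∈ Finset.range (n + 1), D.τ (α i) * D.δ^[i] b = l * g := by
    have := congrArg (coeff 0) e
    have h0 : ∀ i : ℕ, (Finsupp.single i 1 : ℕ →₀ ℕ) ≠ 0 := fun i h => by
      simpa using congrArg Finsupp.degree h
    simpa only [coeff_add, coeff_sum, mul_add, Finset.sum_add_distrib, coeff_C_mul, coeff_X,
      ← C_mul, coeff_C, h0, if_false, mul_zero, if_true, zero_add, Finset.sum_const_zero,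
      add_zero] using this
  by_cases hz : ∀ i ∈ Finset.range (n + 1), α i = 0
  · rw [Finset.sum_eq_zero fun i hi => by rw [show coeff _ Q = 0 from hz i hi, C_0, zero_mul],
      add_zero] at hn
    exact hn
  push Not at hz
  obtain ⟨j, hj, hj0⟩ := hz
  have hl : l ≠ 0 := by
    rintro rfl
    have := e1 j hj
    rw [zero_mul] at this
    exact hj0 ((map_eq_zero D.τ).mp this)
  refine absurd ⟨n, fun i => ⟨α i / α j, ?_⟩, -g / α j, ⟨⟨j, Finset.mem_range.mp hj⟩, ?_⟩, ?_⟩ hb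
  · change D.τ _ = _
    rw [map_div₀, e1 _ (Finset.mem_range.mpr i.2), e1 j hj, mul_div_mul_left _ _ hl]
    rfl
  · intro h0
    have := congrArg Subtype.val h0
    simp [hj0] at this
  · rw [Fin.sum_univ_eq_sum_range (fun i => α i / α j * D.δ^[i] b)]
    rw [Finset.sum_congr rfl fun i hi => by rw [e1 i hi]] at e0
    have e2 : ∑ i ∈ Finset.range (n + 1), α i / α j * D.δ^[i] b =
        (∑ i ∈ Finset.range (n + 1), l * α i * D.δ^[i] b) / (l * α j) := by
      rw [Finset.sum_div]
      refine Finset.sum_congr rfl fun i _ => ?_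
      field_simp
    rw [e2, eq_sub_of_add_eq' e0, map_div₀, map_neg, e1 j hj]
    field_simp
    ring

/-- Without telescopers the semi-invariants of the shift are constant polynomials. -/
theorem eq_C_of_shift_eq_smul [CharZero K] {b l : K} (hb : ¬ D.HasTelescoper b)
    {Q : MvPolynomial ℕ K} (hQ : D.shift 1 b Q = C l * Q) : Q = C (coeff 0 Q) := by
  suffices H : ∀ (n : ℕ) (Q : MvPolynomial ℕ K), (∀ m : ℕ →₀ ℕ, n < m.degree → coeff m Q = 0) →
      D.shift 1 b Q = C l * Q → Q = C (coeff 0 Q) by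
    refine H Q.totalDegree Q (fun m hm => ?_) hQ
    exact coeff_eq_zero_of_totalDegree_lt hm
  intro n
  induction n with
  | zero => exact fun Q h hQ => eq_C_of_shift_eq_smul_of_linear hb hQ fun m hm => h m (by omega)
  | succ n ih =>
    -- The partial derivatives satisfy the same equation in lower degree, so they are constant and
    -- `Q` has degree at most one.
    refine fun Q h hQ => eq_C_of_shift_eq_smul_of_linear hb hQ fun m hm =>
      coeff_eq_zero_of_pderiv_eq_C (fun i => ih _ (fun m hm => ?_) ?_) hm
    · rw [coeff_pderiv, h _ (by simpa using hm), zero_mul]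
    · rw [← pderiv_shift_one, hQ, Derivation.leibniz]
      simp

/-- Without telescopers, `σ Q = a Q + c` with `c` in `K` has only constant solutions. -/
theorem eq_C_of_shift_eq_smul_add_C [CharZero K] {a b c : K} (ha : a ≠ 0) (hb : b = D.δ a / a)
    (ht : ¬ D.HasTelescoper b)
    {Q : MvPolynomial ℕ K} (hQ : D.shift 1 b Q = C a * Q + C c) : Q = C (coeff 0 Q) := by
  refine eq_C_of_forall_pderiv_eq_zero fun i => ?_
  have h1 : D.shift 1 b (pderiv i Q) = C a * pderiv i Q := by
    rw [← pderiv_shift_one, hQ, map_add, Derivation.leibniz]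
    simp
  have h2 := eq_C_of_shift_eq_smul ht h1
  rw [h2, shift_C, ← C_mul] at h1
  by_contra h0
  -- A nonzero partial derivative is a constant `c` with `τ c = a * c`.
  refine ht (hb ▸ hasTelescoper_of_eq_pow_mul ha (c := coeff 0 (pderiv i Q)) (m := 1) ?_
    one_ne_zero ?_)
  · intro h3
    rw [h3, C_0] at h2
    exact h0 h2
  · rw [pow_one]
    exact C_injective _ _ h1

end

/-! ### Leading forms and total degree -/

theorem aeval_mul_of_isHomogeneous {K A : Type*} [CommRing K] [CommRing A] [Algebra K A]
    {P : MvPolynomial ℕ K} {d : ℕ} (hP : P.IsHomogeneous d) (c : A) (v : ℕ → A) :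
    aeval (fun i => c * v i) P = c ^ d * aeval v P := by
  rw [aeval_def, aeval_def, eval₂_eq, eval₂_eq, Finset.mul_sum]
  refine Finset.sum_congr rfl fun m hm => ?_
  have : ∑ i ∈ m.support, m i = d := by
    exact (DFunLike.congr_fun Finsupp.degree_eq_weight_one m).trans (hP (mem_support_iff.mp hm))
  rw [← this, ← Finset.prod_pow_eq_pow_sum]
  simp only [mul_pow, Finset.prod_mul_distrib]
  ring

theorem coeff_prod_linear {R : Type*} [CommRing R] (u v : ℕ → R) (m : ℕ → ℕ) (s : Finset ℕ) :
    (∏ i ∈ s, (Polynomial.C (u i) * Polynomial.X + Polynomial.C (v i)) ^ m i).natDegree ≤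
        ∑ i ∈ s, m i ∧
      (∏ i ∈ s, (Polynomial.C (u i) * Polynomial.X + Polynomial.C (v i)) ^ m i).coeff
        (∑ i ∈ s, m i) = ∏ i ∈ s, u i ^ m i := by
  have h1 : ∀ i, (Polynomial.C (u i) * Polynomial.X + Polynomial.C (v i)).natDegree ≤ 1 :=
    fun i => Polynomial.natDegree_linear_le
  have h2 : ∀ i, ((Polynomial.C (u i) * Polynomial.X + Polynomial.C (v i)) ^ m i).natDegree ≤
      m i := fun i => by simpa using Polynomial.natDegree_pow_le_of_le (m i) (h1 i)
  induction s using Finset.induction_on with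
  | empty => simp
  | insert i s hi ih =>
    rw [Finset.prod_insert hi, Finset.sum_insert hi, Finset.prod_insert hi]
    refine ⟨Polynomial.natDegree_mul_le_of_le (h2 i) ih.1, ?_⟩
    rw [Polynomial.coeff_mul_add_eq_of_natDegree_le (h2 i) ih.1, ih.2]
    have := Polynomial.coeff_pow_of_natDegree_le (m := m i) (h1 i)
    rw [mul_one] at this
    rw [this]
    simp

/-- A monomial of degree `e` becomes a polynomial of degree at most `e`, so only monomials of degree
exactly `d` reach the `d`-th coefficient, through their linear parts `u i`. -/
theorem coeff_eval₂_linear {K R : Type*} [CommRing K] [CommRing R] (g : K →+* R) (u v : ℕ → R)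
    {P : MvPolynomial ℕ K} {d : ℕ} (hP : P.totalDegree ≤ d) :
    (eval₂ (Polynomial.C.comp g)
      (fun i => Polynomial.C (u i) * Polynomial.X + Polynomial.C (v i)) P).coeff d =
      eval₂ g u (homogeneousComponent d P) := by
  rw [homogeneousComponent_apply, eval₂_sum, eval₂_eq, Polynomial.finsetSum_coeff,
    Finset.sum_filter]
  refine Finset.sum_congr rfl fun m hm => ?_
  rw [RingHom.comp_apply, Polynomial.coeff_C_mul, eval₂_monomial]
  have hc := coeff_prod_linear u v m m.support
  have hmd : m.degree ≤ d := (le_totalDegree hm).trans hP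
  split_ifs with h
  · subst h
    exact congrArg _ hc.2
  · rw [Polynomial.coeff_eq_zero_of_natDegree_lt (hc.1.trans_lt (lt_of_le_of_ne hmd h)), mul_zero]

theorem totalDegree_eval₂_le {K L : Type*} [CommRing K] [CommRing L] (g : K →+* L)
    {v : ℕ → MvPolynomial ℕ L} (hv : ∀ i, (v i).totalDegree ≤ 1) (P : MvPolynomial ℕ K) :
    (eval₂ (C.comp g) v P).totalDegree ≤ P.totalDegree := by
  rw [eval₂_eq]
  refine totalDegree_finsetSum_le fun m hm => ?_
  refine (totalDegree_mul _ _).trans ?_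
  rw [RingHom.comp_apply, totalDegree_C, zero_add]
  refine (totalDegree_finsetProd _ _).trans (le_trans ?_ (le_totalDegree hm))
  refine Finset.sum_le_sum fun i _ => (totalDegree_pow _ _).trans ?_
  simpa using Nat.mul_le_mul_left (m i) (hv i)

theorem exists_degree_eq_totalDegree {K : Type*} [CommRing K] {P : MvPolynomial ℕ K}
    (h : P ≠ 0) : ∃ m ∈ P.support, P.totalDegree = m.degree :=
  Finset.exists_mem_eq_sup _ (support_nonempty.mpr h) _

theorem totalDegree_lt_of_homogeneousComponent_eq_zero {K : Type*} [CommRing K]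
    {P : MvPolynomial ℕ K} {d : ℕ} (hP : P.totalDegree ≤ d) (h : homogeneousComponent d P = 0)
    (h0 : P ≠ 0) : P.totalDegree < d := by
  refine lt_of_le_of_ne hP fun hd => ?_
  obtain ⟨m, hm, hmd⟩ := exists_degree_eq_totalDegree h0
  have := congrArg (coeff m) h
  rw [coeff_homogeneousComponent, if_pos (by rw [← hd, ← hmd]), coeff_zero] at this
  exact mem_support_iff.mp hm this

/-! ### Shift-stable subspaces -/

section

variable {K : Type*} [Field K] {D : DiffDiffStructure K}

/-- A translation disturbs only lower degrees. The induction passes to a partial derivative and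
cancels the exponent. -/
theorem coeff_shift_one_of_degree [CharZero K] (b : K) {Q : MvPolynomial ℕ K} {m : ℕ →₀ ℕ}
    (h : ∀ m' : ℕ →₀ ℕ, m.degree < m'.degree → coeff m' Q = 0) :
    coeff m (D.shift 1 b Q) = D.τ (coeff m Q) := by
  induction hn : m.degree generalizing m Q with
  | zero =>
    have hQ : Q = C (coeff 0 Q) := by
      ext m'
      rw [coeff_C]
      split_ifs with h0
      · rw [h0]
      · exact h m' (hn ▸ Nat.pos_of_ne_zero fun h1 =>
          h0 ((Finsupp.degree_eq_zero_iff m').mp h1).symm)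
    rw [hQ, shift_C, (Finsupp.degree_eq_zero_iff m).mp hn]
    simp
  | succ n ih =>
    have hm0 : m ≠ 0 := by rintro rfl; simp at hn
    obtain ⟨i, hi⟩ := Finsupp.ne_iff.mp hm0
    have hle : Finsupp.single i 1 ≤ m := by
      rw [Finsupp.single_le_iff]
      exact Nat.one_le_iff_ne_zero.mpr hi
    have hadd := tsub_add_cancel_of_le hle
    have hdeg := congrArg Finsupp.degree hadd
    rw [map_add, Finsupp.degree_single] at hdeg
    have h1 := ih (m := m - Finsupp.single i 1) (Q := pderiv i Q) (fun m' hm' => by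
      rw [coeff_pderiv, h _ (by rw [map_add, Finsupp.degree_single]; omega), zero_mul]) (by omega)
    rw [← pderiv_shift_one, coeff_pderiv, coeff_pderiv, hadd, map_mul] at h1
    have : (((m - Finsupp.single i 1 : ℕ →₀ ℕ) i : K) + 1) ≠ 0 := by
      exact_mod_cast Nat.succ_ne_zero ((m - Finsupp.single i 1 : ℕ →₀ ℕ) i)
    rw [map_add, map_natCast, map_one] at h1
    exact mul_right_cancel₀ this h1

/-- Without telescopers, a nonzero shift-stable space of differential polynomials contains `1`. -/
theorem one_mem_of_shift_mem [CharZero K] {b : K} (hb : ¬ D.HasTelescoper b)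
    (U : Submodule K (MvPolynomial ℕ K)) (hU : ∀ Q ∈ U, D.shift 1 b Q ∈ U)
    {P : MvPolynomial ℕ K} (hP : P ∈ U) (hP0 : P ≠ 0) : 1 ∈ U := by
  -- Minimize the degree first, then the number of monomials of top degree.
  let μ : MvPolynomial ℕ K → Lex (ℕ × ℕ) := fun Q =>
    toLex (Q.totalDegree, (Q.support.filter fun m => m.degree = Q.totalDegree).card)
  obtain ⟨Q, ⟨hQ, hQ0⟩, hmin⟩ := (InvImage.wf μ wellFounded_lt).has_min
    {Q | Q ∈ U ∧ Q ≠ 0} ⟨P, hP, hP0⟩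
  obtain ⟨m, hm, hmd⟩ := exists_degree_eq_totalDegree hQ0
  set c := coeff m Q with hc
  have hc0 : c ≠ 0 := mem_support_iff.mp hm
  -- This combination kills the top monomial `m` and creates no new one, so minimality forces `N =
  -- 0`: `Q` is semi-invariant.
  set N := c • D.shift 1 b Q - D.τ c • Q with hN
  have hNU : N ∈ U := U.sub_mem (U.smul_mem _ (hU Q hQ)) (U.smul_mem _ hQ)
  have hQv : ∀ m' : ℕ →₀ ℕ, Q.totalDegree < m'.degree → coeff m' Q = 0 := fun m' h =>
    coeff_eq_zero_of_totalDegree_lt h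
  have hcN : ∀ m' : ℕ →₀ ℕ, Q.totalDegree ≤ m'.degree →
      coeff m' N = c * D.τ (coeff m' Q) - D.τ c * coeff m' Q := fun m' h => by
    rw [hN, coeff_sub, coeff_smul, coeff_smul,
      coeff_shift_one_of_degree b fun m'' h' => hQv m'' (h.trans_lt h'), smul_eq_mul, smul_eq_mul]
  have hN0 : N = 0 := by
    by_contra h0
    apply hmin N ⟨hNU, h0⟩
    have hle : N.totalDegree ≤ Q.totalDegree := by
      refine Finset.sup_le fun m' hm' => ?_
      by_contra hlt
      have hlt' : Q.totalDegree < m'.degree := not_le.mp hlt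
      refine mem_support_iff.mp hm' ?_
      rw [hcN _ hlt'.le, hQv _ hlt']
      simp
    refine Prod.Lex.toLex_lt_toLex.mpr ?_
    rcases hle.lt_or_eq with h | h
    · exact Or.inl h
    · refine Or.inr ⟨h, Finset.card_lt_card (Finset.ssubset_iff_of_subset ?_ |>.mpr ⟨m, ?_, ?_⟩)⟩
      · intro m' hm'
        rw [Finset.mem_filter] at hm' ⊢
        refine ⟨mem_support_iff.mpr fun h1 => mem_support_iff.mp hm'.1 ?_, hm'.2.trans h⟩
        rw [hcN _ (by rw [hm'.2, h]), h1]
        simp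
      · exact Finset.mem_filter.mpr ⟨hm, hmd.symm⟩
      · rw [Finset.mem_filter, not_and_or]
        left
        rw [notMem_support_iff, hcN _ hmd.le, ← hc, mul_comm, sub_self]
  have hs : D.shift 1 b Q = C (c⁻¹ * D.τ c) * Q := by
    rw [C_mul', mul_smul, ← sub_eq_zero.mp hN0, smul_smul, inv_mul_cancel₀ hc0, one_smul]
  have hq := eq_C_of_shift_eq_smul hb hs
  have hq0 : coeff 0 Q ≠ 0 := fun h => hQ0 (by rw [hq, h, C_0])
  have h1 : (coeff 0 Q)⁻¹ • Q = 1 := by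
    rw [← C_mul', hq, coeff_C, if_pos rfl, ← C_mul, inv_mul_cancel₀ hq0, C_1]
  exact h1 ▸ U.smul_mem _ hQ

end

/-! ### The exponential substitution -/

section

variable {K : Type*} [Field K] (D : DiffDiffStructure K)

/-- The derivation twisted by `j` times the logarithmic derivative `X 0`. -/
noncomputable def twist (j : ℕ) (x : MvPolynomial ℕ K) : MvPolynomial ℕ K :=
  D.dd x + (j : MvPolynomial ℕ K) * X 0 * x

/-- The `i`-th derivative of `z` is `z` times `D.bell i` evaluated at the logarithmic
derivative of `z`. -/
noncomputable def bell (i : ℕ) : MvPolynomial ℕ K := (D.twist 1)^[i] 1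

theorem bell_zero : D.bell 0 = 1 := rfl

theorem bell_succ (i : ℕ) : D.bell (i + 1) = D.dd (D.bell i) + X 0 * D.bell i := by
  rw [bell, Function.iterate_succ_apply', ← bell, twist, Nat.cast_one, one_mul]

theorem bell_one : D.bell 1 = X 0 := by
  rw [bell_succ, bell_zero, Derivation.map_one_eq_zero, zero_add, mul_one]

variable {D}

/-- If `z` has logarithmic derivative `X 0`, then `a z` has `X 0 + b`; both sides are the `i`-th
derivative of `a z` divided by `z`. -/
theorem C_mul_shift_bell {a b : K} (ha : a ≠ 0) (hb : b = D.δ a / a) (i : ℕ) :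
    C a * D.shift 1 b (D.bell i) = (D.twist 1)^[i] (C a) := by
  induction i with
  | zero => simp [bell_zero]
  | succ n ih =>
    have hab : D.δ a = a * b := by rw [hb]; field_simp
    rw [Function.iterate_succ_apply', ← ih, bell_succ, map_add, map_mul, shift_dd, twist,
      Derivation.leibniz, dd_C, shift_one_X, hab, C_mul]
    simp only [smul_eq_mul, Function.iterate_zero, id_eq, Nat.cast_one]
    ring

variable (D) in
/-- The substitution `X i ↦ i`-th derivative of `t`, where `t` is a variable whose logarithmic
derivative is `X 0`. -/
noncomputable def expSubst : MvPolynomial ℕ K →+* Polynomial (MvPolynomial ℕ K) :=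
  eval₂Hom (Polynomial.C.comp C) fun i => Polynomial.C (D.bell i) * Polynomial.X

theorem expSubst_C (x : K) : D.expSubst (C x) = Polynomial.C (C x) := by simp [expSubst]

theorem expSubst_X (i : ℕ) : D.expSubst (X i) = Polynomial.C (D.bell i) * Polynomial.X := by
  simp [expSubst]

/-- This is `(q t ^ j)' = (q' + j * X 0 * q) t ^ j`. -/
theorem coeff_expSubst_dd (j : ℕ) (P : MvPolynomial ℕ K) :
    (D.expSubst (D.dd P)).coeff j = D.twist j ((D.expSubst P).coeff j) := by
  induction P using MvPolynomial.induction_on generalizing j with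
  | C x =>
    rw [dd_C, expSubst_C, expSubst_C, Polynomial.coeff_C, Polynomial.coeff_C, twist]
    split_ifs with h
    · simp [h]
    · simp
  | add p q hp hq =>
    simp only [map_add, Polynomial.coeff_add, hp, hq, twist]
    ring
  | mul_X p i hp =>
    rw [Derivation.leibniz, dd_X, map_add, smul_eq_mul, smul_eq_mul, map_mul, map_mul, map_mul,
      expSubst_X, expSubst_X, Polynomial.coeff_add]
    have e : ∀ (q : Polynomial (MvPolynomial ℕ K)) c, q * (Polynomial.C c * Polynomial.X) =
        q * Polynomial.C c * Polynomial.X := fun q c => by ring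
    rw [mul_comm _ (D.expSubst (D.dd p)), e, e, e]
    cases j with
    | zero => simp [twist]
    | succ n =>
      simp only [Polynomial.coeff_mul_X, Polynomial.coeff_mul_C, hp, twist, bell_succ,
        Derivation.leibniz, smul_eq_mul]
      push_cast
      ring

theorem expSubst_shift_X {a b f : K} (ha : a ≠ 0) (hb : b = D.δ a / a) (i : ℕ) :
    D.expSubst (D.shift a f (X i)) =
      Polynomial.C (C a * D.shift 1 b (D.bell i)) * Polynomial.X +
        Polynomial.C (C (D.δ^[i] f)) := by
  have h : ∀ j P, (D.expSubst (D.dd^[i] P)).coeff j = (D.twist j)^[i] ((D.expSubst P).coeff j) :=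
    fun j => Function.Semiconj.iterate_right (f := fun P => (D.expSubst P).coeff j)
      (coeff_expSubst_dd j) i
  ext1 j
  rw [shift_X, h, map_add, map_mul, expSubst_C, expSubst_C, expSubst_X, bell_zero, map_one, one_mul,
    C_mul_shift_bell ha hb]
  match j with
  | 0 =>
    have h0 : D.twist 0 = D.dd := by
      ext1 x
      simp [twist]
    simp [h0, dd_iterate_C]
  | 1 => simp [Polynomial.coeff_C]
  | j + 2 =>
    have h0 : D.twist (j + 2) 0 = 0 := by simp [twist]
    simp [Function.iterate_fixed h0]

/-- The summand `f` contributes only to lower powers of `t`; on top, `t ↦ a t` gives the factor `a ^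
d` and adds `b` to the logarithmic derivative. -/
theorem coeff_expSubst_shift {a b f : K} (ha : a ≠ 0) (hb : b = D.δ a / a)
    {P : MvPolynomial ℕ K} {d : ℕ} (hP : P.totalDegree ≤ d) :
    (D.expSubst (D.shift a f P)).coeff d =
      C a ^ d * D.shift 1 b ((D.expSubst P).coeff d) := by
  have h1 : D.expSubst (D.shift a f P) = eval₂ (Polynomial.C.comp (C.comp D.τ))
      (fun i => Polynomial.C (C a * D.shift 1 b (D.bell i)) * Polynomial.X +
        Polynomial.C (C (D.δ^[i] f))) P := by
    rw [← coe_eval₂Hom, ← RingHom.comp_apply]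
    congr 1
    refine MvPolynomial.ringHom_ext (fun x => ?_) fun i => ?_
    · simp [expSubst_C]
    · rw [RingHom.comp_apply, expSubst_shift_X ha hb, eval₂Hom_X']
  have h2 := coeff_eval₂_linear C D.bell (fun _ => 0) hP
  simp only [map_zero, add_zero] at h2
  have h3 : D.expSubst P = eval₂ (Polynomial.C.comp C)
    (fun i => Polynomial.C (D.bell i) * Polynomial.X) P := rfl
  rw [h1, h3, h2, coeff_eval₂_linear _ _ _ hP]
  have h4 : ∀ Q : MvPolynomial ℕ K, D.shift 1 b (eval₂ C D.bell Q) =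
      eval₂ (C.comp D.τ) (fun i => D.shift 1 b (D.bell i)) Q := fun Q => by
    rw [hom_eval₂]
    congr 1
    ext1 x
    simp
  rw [h4]
  have h5 := aeval_mul_of_isHomogeneous
    ((homogeneousComponent_isHomogeneous d P).map D.τ) (C a : MvPolynomial ℕ K)
    (fun i => D.shift 1 b (D.bell i))
  rwa [aeval_def, aeval_def, eval₂_map, eval₂_map] at h5

theorem totalDegree_shift_le (a f : K) (P : MvPolynomial ℕ K) :
    (D.shift a f P).totalDegree ≤ P.totalDegree := by
  refine totalDegree_eval₂_le D.τ (fun i => ?_) P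
  -- The span of `1` and the variables is stable under the derivation.
  suffices h : D.dd^[i] (C a * X 0 + C f) ∈
      Submodule.span K (insert 1 (Set.range (X : ℕ → MvPolynomial ℕ K))) by
    refine Submodule.span_induction ?_ ?_ ?_ ?_ h
    · rintro _ (rfl | ⟨j, rfl⟩) <;> simp
    · simp
    · exact fun x y _ _ hx hy => (totalDegree_add _ _).trans (max_le hx hy)
    · exact fun c x _ hx => (totalDegree_smul_le _ _).trans hx
  have h1 : (1 : MvPolynomial ℕ K) ∈
      Submodule.span K (insert 1 (Set.range (X : ℕ → MvPolynomial ℕ K))) :=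
    Submodule.subset_span (Or.inl rfl)
  have h2 : ∀ j, (X j : MvPolynomial ℕ K) ∈
      Submodule.span K (insert 1 (Set.range (X : ℕ → MvPolynomial ℕ K))) := fun j =>
    Submodule.subset_span (Or.inr ⟨j, rfl⟩)
  induction i with
  | zero =>
    rw [Function.iterate_zero, id_eq, C_mul', ← mul_one (C f), C_mul']
    exact Submodule.add_mem _ (Submodule.smul_mem _ _ (h2 0)) (Submodule.smul_mem _ _ h1)
  | succ n ih =>
    rw [Function.iterate_succ_apply']
    refine Submodule.span_induction ?_ ?_ ?_ ?_ ih
    · rintro _ (rfl | ⟨j, rfl⟩)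
      · simp
      · rw [dd_X]
        exact h2 _
    · simp
    · exact fun x y _ _ hx hy => by
        rw [map_add]
        exact Submodule.add_mem _ hx hy
    · intro c x hx hx'
      rw [← C_mul', Derivation.leibniz, dd_C, smul_eq_mul, smul_eq_mul, mul_comm x, C_mul', C_mul']
      exact Submodule.add_mem _ (Submodule.smul_mem _ _ hx') (Submodule.smul_mem _ _ hx)

variable (D) in
/-- The derivation of the ring of polynomials in the quotients `X (i + 1) = w⁽ⁱ⁺¹⁾ / w`. -/
noncomputable def quotientDerivation : Derivation ℤ (MvPolynomial ℕ K) (MvPolynomial ℕ K) :=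
  extendDerivation D.δ fun i => X (i + 1) - X 0 * X i

variable (D) in
/-- The substitution of `w' / w` for `X 0`, in terms of the quotients `w⁽ⁱ⁺¹⁾ / w`. -/
noncomputable def logSubst : MvPolynomial ℕ K →ₐ[K] MvPolynomial ℕ K :=
  aeval fun i => D.quotientDerivation^[i] (X 0)

/-- The recursion for `bell` matches the quotient rule for `w⁽ⁱ⁺¹⁾ / w`. -/
theorem logSubst_bell_succ (i : ℕ) : D.logSubst (D.bell (i + 1)) = X i := by
  have hd : ∀ P, D.logSubst (D.dd P) = D.quotientDerivation (D.logSubst P) :=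
    map_derivation_of_generators D.dd _ (map_add _) D.quotientDerivation.leibniz
      D.logSubst.toRingHom (fun x => by simp [logSubst, quotientDerivation, algebraMap_eq])
      fun i => by
        rw [dd_X]
        simp [logSubst, Function.iterate_succ_apply']
  induction i with
  | zero => simp [bell_one, logSubst]
  | succ n ih =>
    rw [bell_succ, map_add, map_mul, hd, ih, quotientDerivation, extendDerivation_X]
    simp [logSubst]

/-- A form `P` equals `X 0 ^ d` times its value at the quotients `X i / X 0`, and these are images
of the `bell i`. Hence dehomogenizing through `bell` loses nothing. -/
theorem map_eq_zero_of_aeval_bell_eq_zero {F : Type*} [Field F] [Algebra K F]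
    (ι : MvPolynomial ℕ K →ₐ[K] F) (hx : ι (X 0) ≠ 0) {P : MvPolynomial ℕ K} {d : ℕ}
    (hP : P.IsHomogeneous d) (h : aeval D.bell P = 0) : ι P = 0 := by
  let ρ : MvPolynomial ℕ K →ₐ[K] F := aeval fun i => ι (X (i + 1)) / ι (X 0)
  have h1 : ∀ i, ι (X 0) * ρ (D.logSubst (D.bell i)) = ι (X i) := fun i => by
    cases i with
    | zero => simp [bell_zero]
    | succ n =>
      rw [logSubst_bell_succ]
      simp only [ρ, aeval_X]
      exact mul_div_cancel₀ _ hx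
  have h2 := aeval_mul_of_isHomogeneous hP (ι (X 0)) fun i => ρ (D.logSubst (D.bell i))
  have h3 := comp_aeval_apply D.bell (ρ.comp D.logSubst) P
  rw [h, map_zero] at h3
  simp only [AlgHom.comp_apply] at h3
  rw [← h3, mul_zero] at h2
  simp only [h1] at h2
  have h4 := comp_aeval_apply X ι P
  rw [aeval_X_left_apply] at h4
  exact h4.trans h2

theorem eq_zero_of_isHomogeneous_of_aeval_bell {P : MvPolynomial ℕ K} {d : ℕ}
    (hP : P.IsHomogeneous d) (h : aeval D.bell P = 0) : P = 0 := by
  have hι : Function.Injective (Algebra.algHom K (MvPolynomial ℕ K)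
      (FractionRing (MvPolynomial ℕ K))) := IsFractionRing.injective _ _
  exact hι ((map_eq_zero_of_aeval_bell_eq_zero _ (fun h0 => X_ne_zero (R := K) 0
    (hι (h0.trans (map_zero _).symm))) hP h).trans (map_zero _).symm)

theorem coeff_expSubst {P : MvPolynomial ℕ K} {d : ℕ} (hP : P.totalDegree ≤ d) :
    (D.expSubst P).coeff d = aeval D.bell (homogeneousComponent d P) := by
  have h2 := coeff_eval₂_linear C D.bell (fun _ => 0) hP
  simp only [map_zero, add_zero] at h2
  exact h2

theorem totalDegree_lt_of_coeff_expSubst {P : MvPolynomial ℕ K} {d : ℕ} (hP : P.totalDegree ≤ d)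
    (h : (D.expSubst P).coeff d = 0) (h0 : P ≠ 0) : P.totalDegree < d := by
  rw [coeff_expSubst hP] at h
  exact totalDegree_lt_of_homogeneousComponent_eq_zero hP
    (eq_zero_of_isHomogeneous_of_aeval_bell (homogeneousComponent_isHomogeneous d P) h) h0

end

/-! ### Minimal relations and their consequences -/

section

variable {K : Type*} [Field K] {D : DiffDiffStructure K}
  {A : Type*} [CommRing A] [Algebra K A] {E : DiffDiffStructure A}

/-- A differential equation of minimal total degree can be chosen semi-invariant under the shift
and with leading form a power of the variable `X 0`. -/
theorem exists_minimal_relation [CharZero K] [Nontrivial A] (hE : D.Extends E) {a f : K}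
    (ha : a ≠ 0) (ht : ¬ D.HasTelescoper (D.δ a / a)) {w : A}
    (hw : E.τ w = algebraMap K A a * w + algebraMap K A f)
    (hd : E.DifferentiallyAlgebraic K w) :
    ∃ (d : ℕ) (P : MvPolynomial ℕ K), d ≠ 0 ∧ (P ≠ 0 → P.totalDegree < d) ∧
      E.evalDiff K w (X 0 ^ d + P) = 0 ∧
      D.shift a f (X 0 ^ d + P) = C a ^ d * (X 0 ^ d + P) := by
  classical
  have hex : ∃ d, ∃ P : MvPolynomial ℕ K, P ≠ 0 ∧ E.evalDiff K w P = 0 ∧ P.totalDegree = d := by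
    obtain ⟨P, hP, h⟩ := hd
    exact ⟨_, P, hP, h, rfl⟩
  set d := Nat.find hex with hdef
  have hmin : ∀ P : MvPolynomial ℕ K, E.evalDiff K w P = 0 → P.totalDegree < d → P = 0 := by
    intro P h hlt
    by_contra h0
    exact Nat.find_min hex hlt ⟨P, h0, h, rfl⟩
  obtain ⟨P₀, hP₀, hw₀, hd₀⟩ := Nat.find_spec hex
  have hCP : ∀ (c : K) (P : MvPolynomial ℕ K),
      (D.expSubst (C c * P)).coeff d = C c * (D.expSubst P).coeff d := fun c P => by
    rw [map_mul, expSubst_C, Polynomial.coeff_C_mul]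
  -- The degree-`d` forms of the relations of degree at most `d`, dehomogenized.
  let U : Submodule K (MvPolynomial ℕ K) :=
    { carrier := {q | ∃ P : MvPolynomial ℕ K, E.evalDiff K w P = 0 ∧ P.totalDegree ≤ d ∧
        (D.expSubst P).coeff d = q}
      zero_mem' := ⟨0, by simp, by simp, by simp⟩
      add_mem' := by
        rintro _ _ ⟨P, h1, h2, rfl⟩ ⟨Q, h3, h4, rfl⟩
        exact ⟨P + Q, by rw [map_add, h1, h3, add_zero],
          (totalDegree_add _ _).trans (max_le h2 h4), by rw [map_add, Polynomial.coeff_add]⟩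
      smul_mem' := by
        rintro c _ ⟨P, h1, h2, rfl⟩
        exact ⟨C c * P, by rw [map_mul, h1, mul_zero],
          (totalDegree_mul _ _).trans (by rwa [totalDegree_C, zero_add]), by
            rw [hCP, C_mul']⟩ }
  have hshift : ∀ P : MvPolynomial ℕ K, E.evalDiff K w P = 0 →
      E.evalDiff K w (D.shift a f P) = 0 := fun P h => by
    rw [evalDiff_shift hE hw, h, map_zero]
  have hU : ∀ q ∈ U, D.shift 1 (D.δ a / a) q ∈ U := by
    rintro _ ⟨P, h1, h2, rfl⟩
    refine ⟨C (a ^ d)⁻¹ * D.shift a f P, by rw [map_mul, hshift P h1, mul_zero],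
      (totalDegree_mul _ _).trans ?_, ?_⟩
    · rw [totalDegree_C, zero_add]
      exact (totalDegree_shift_le a f P).trans h2
    · rw [hCP, coeff_expSubst_shift ha rfl h2, ← mul_assoc, ← C_pow, ← C_mul,
        inv_mul_cancel₀ (pow_ne_zero d ha), C_1, one_mul]
  obtain ⟨P, h1, h2, h3⟩ : (1 : MvPolynomial ℕ K) ∈ U :=
    one_mem_of_shift_mem ht U hU (P := (D.expSubst P₀).coeff d) ⟨P₀, hw₀, hd₀.le, rfl⟩
      fun h => (totalDegree_lt_of_coeff_expSubst hd₀.le h hP₀).ne hd₀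
  refine ⟨d, P - X 0 ^ d, ?_, ?_, ?_, ?_⟩
  · intro hd0
    have hPC := totalDegree_eq_zero_iff_eq_C.mp (Nat.le_zero.mp (hd0 ▸ h2))
    rw [hPC, evalDiff_C] at h1
    have hc := (map_eq_zero (algebraMap K A)).mp h1
    rw [hPC, hc] at h3
    simp at h3
  · refine totalDegree_lt_of_coeff_expSubst (D := D) ((totalDegree_sub _ _).trans (max_le h2 ?_)) ?_
    · simp
    · rw [map_sub, map_pow, expSubst_X, bell_zero, map_one, one_mul, Polynomial.coeff_sub, h3,
        Polynomial.coeff_X_pow_self, sub_self]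
  · rwa [add_sub_cancel]
  · rw [add_sub_cancel, ← sub_eq_zero]
    -- The difference is a relation whose coefficient of `t ^ d` vanishes, so its degree contradicts
    -- the minimality of `d`.
    by_contra h0
    have h4 : (D.shift a f P - C a ^ d * P).totalDegree ≤ d := by
      refine (totalDegree_sub _ _).trans (max_le ((totalDegree_shift_le a f P).trans h2) ?_)
      rw [← C_pow]
      exact (totalDegree_mul _ _).trans (by rwa [totalDegree_C, zero_add])
    refine h0 (hmin _ ?_ (totalDegree_lt_of_coeff_expSubst (D := D) h4 ?_ h0))
    · rw [map_sub, map_mul, h1, hshift P h1, mul_zero, sub_zero]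
    · rw [← C_pow, map_sub, Polynomial.coeff_sub, hCP, coeff_expSubst_shift ha rfl h2, h3, map_one,
        C_pow, sub_self]

/-- Without telescopers, differentially algebraic solutions of `τ z = a z` are nilpotent. -/
theorem isNilpotent_of_differentiallyAlgebraic [CharZero K] [Nontrivial A] (hE : D.Extends E)
    {a : K} (ha : a ≠ 0) (ht : ¬ D.HasTelescoper (D.δ a / a)) {z : A}
    (hz : E.τ z = algebraMap K A a * z) (hd : E.DifferentiallyAlgebraic K z) :
    IsNilpotent z := by
  obtain ⟨d, P, -, hlt, hP, hs⟩ := exists_minimal_relation hE (f := 0) ha ht (by simpa using hz) hd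
  refine ⟨d, ?_⟩
  have hP0 : P = 0 := by
    by_contra h0
    have hlt := hlt h0
    rw [map_add, map_pow, shift_X, Function.iterate_zero, id_eq, C_0, add_zero, mul_pow, mul_add,
      add_right_inj] at hs
    -- As `f = 0`, the power `X 0 ^ d` is semi-invariant by itself, hence so is `P`. Its top
    -- coefficient satisfies `σ q = a ^ (k + 1) * q` with `k + 1 = d - P.totalDegree`.
    set q := (D.expSubst P).coeff P.totalDegree with hq
    have hq0 : q ≠ 0 := fun h => (totalDegree_lt_of_coeff_expSubst le_rfl h h0).false
    have h1 := coeff_expSubst_shift (D := D) (f := 0) ha rfl (P := P) le_rfl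
    rw [hs, map_mul, map_pow, expSubst_C, ← Polynomial.C_pow, Polynomial.coeff_C_mul, ← hq] at h1
    obtain ⟨k, hk⟩ := Nat.exists_eq_add_of_lt hlt
    rw [hk, add_assoc, pow_add, mul_assoc] at h1
    have h2 := (mul_left_cancel₀ (pow_ne_zero _ (C_ne_zero.mpr ha)) h1).symm
    rw [← C_pow] at h2
    have h3 := eq_C_of_shift_eq_smul ht h2
    rw [h3, shift_C, ← C_mul] at h2
    exact ht (hasTelescoper_of_eq_pow_mul ha (fun h => hq0 (by rw [h3, h, C_0]))
      (Nat.succ_ne_zero k) (C_injective _ _ h2))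
  rw [hP0, add_zero, map_pow, evalDiff_X] at hP
  exact hP

/-- Without telescopers, a differentially algebraic solution of `τ w = a w + f` forces a solution
of this equation in the base field. -/
theorem exists_solution_of_differentiallyAlgebraic [CharZero K] [Nontrivial A] (hE : D.Extends E)
    {a f : K} (ha : a ≠ 0) (ht : ¬ D.HasTelescoper (D.δ a / a)) {w : A}
    (hw : E.τ w = algebraMap K A a * w + algebraMap K A f)
    (hd : E.DifferentiallyAlgebraic K w) : ∃ u : K, D.τ u = a * u + f := by
  obtain ⟨d, P, hd0, hlt, -, hs⟩ := exists_minimal_relation hE ha ht hw hd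
  obtain ⟨k, rfl⟩ := Nat.exists_eq_succ_of_ne_zero hd0
  have hPk : P.totalDegree ≤ k := by
    by_cases h : P = 0
    · simp [h]
    · exact Nat.le_of_lt_succ (hlt h)
  set q := (D.expSubst P).coeff k with hq
  -- Compare the coefficients just below the top; the binomial term of `(a t + f) ^ (k + 1)` brings
  -- in `f`.
  have h1 := congrArg (fun Q => (D.expSubst Q).coeff k) hs
  have hlin : Polynomial.C (C a) * Polynomial.X + Polynomial.C (C f) =
      Polynomial.C (C a : MvPolynomial ℕ K) * (Polynomial.X + Polynomial.C (C (f / a))) := by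
    rw [mul_add, ← Polynomial.C_mul, ← C_mul, mul_div_cancel₀ _ ha]
  have h2 : (D.expSubst (D.shift a f (X 0 ^ (k + 1)))).coeff k =
      C (a ^ k * ((k + 1 : ℕ) * f)) := by
    rw [map_pow, map_pow, shift_X, Function.iterate_zero, id_eq, map_add, map_mul, expSubst_C,
      expSubst_C, expSubst_X, bell_zero, map_one, one_mul, hlin, mul_pow, ← Polynomial.C_pow,
      Polynomial.coeff_C_mul, Polynomial.coeff_X_add_C_pow, Nat.add_sub_cancel_left, pow_one,
      Nat.choose_succ_self_right, ← C_pow, ← map_natCast (C : K →+* MvPolynomial ℕ K), ← C_mul,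
      ← C_mul]
    congr 1
    field_simp
    ring
  have h3 : (D.expSubst (C a ^ (k + 1) * (X 0 ^ (k + 1) + P))).coeff k = C a ^ (k + 1) * q := by
    rw [map_mul, map_pow, expSubst_C, ← Polynomial.C_pow, Polynomial.coeff_C_mul, map_add,
      map_pow, expSubst_X, bell_zero, map_one, one_mul, Polynomial.coeff_add,
      Polynomial.coeff_X_pow, if_neg (by omega), zero_add]
  simp only [map_add (D.shift a f), map_add D.expSubst, Polynomial.coeff_add] at h1
  rw [h2, coeff_expSubst_shift ha rfl hPk, ← hq] at h1
  have h4 : D.shift 1 (D.δ a / a) q = C a * q + C (-((k + 1 : ℕ) * f)) := by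
    refine mul_left_cancel₀ (pow_ne_zero k (C_ne_zero.mpr ha) : (C a : MvPolynomial ℕ K) ^ k ≠ 0) ?_
    have h5 := h1.trans h3
    rw [C_mul, C_pow] at h5
    rw [eq_sub_of_add_eq' h5, C_neg]
    ring
  have h5 := eq_C_of_shift_eq_smul_add_C ha rfl ht h4
  rw [h5, shift_C, ← C_mul, ← C_add] at h4
  have h6 := C_injective _ _ h4
  have hk : ((k + 1 : ℕ) : K) ≠ 0 := Nat.cast_ne_zero.mpr k.succ_ne_zero
  -- The constant `q` satisfies `τ q = a q - (k + 1) f`; rescale it.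
  refine ⟨-coeff 0 q / (k + 1 : ℕ), ?_⟩
  rw [map_div₀, map_neg, h6, map_natCast]
  field_simp
  ring

theorem DifferentiallyAlgebraic.sub_algebraMap (hE : D.Extends E) {w : A}
    (hd : E.DifferentiallyAlgebraic K w) (u : K) :
    E.DifferentiallyAlgebraic K (w - algebraMap K A u) := by
  obtain ⟨P, hP, h⟩ := hd
  let t : K → MvPolynomial ℕ K →ₐ[K] MvPolynomial ℕ K := fun v =>
    aeval fun i => X i + C (D.δ^[i] v)
  refine ⟨t u P, fun h0 => hP ?_, ?_⟩
  · have h1 : (t (-u)).comp (t u) = AlgHom.id K _ := by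
      refine MvPolynomial.algHom_ext fun i => ?_
      simp [t, iterate_map_neg, algebraMap_eq]
    have h2 := DFunLike.congr_fun h1 P
    rw [AlgHom.comp_apply, h0, map_zero] at h2
    exact h2.symm
  · have h1 : (E.evalDiff K (w - algebraMap K A u)).comp (t u) = E.evalDiff K w := by
      refine MvPolynomial.algHom_ext fun i => ?_
      rw [AlgHom.comp_apply, evalDiff_X]
      simp only [t, aeval_X, map_add]
      rw [evalDiff_X, evalDiff_C, iterate_map_sub,
        map_iterate (φ := algebraMap K A) (fun x => (hE.δ_algebraMap x).symm), sub_add_cancel]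
    exact (DFunLike.congr_fun h1 P).trans h

theorem not_differentiallyAlgebraic_of_not_hasTelescoper [CharZero K] [Nontrivial A] [IsReduced A]
    (hE : D.Extends E) {a f : K} (ha : a ≠ 0) (ht : ¬ D.HasTelescoper (D.δ a / a)) {w : A}
    (hwK : w ∉ Set.range (algebraMap K A))
    (hw : E.τ w = algebraMap K A a * w + algebraMap K A f) :
    ¬ E.DifferentiallyAlgebraic K w := by
  intro hd
  obtain ⟨u, hu⟩ := exists_solution_of_differentiallyAlgebraic hE ha ht hw hd
  have h1 : E.τ (w - algebraMap K A u) = algebraMap K A a * (w - algebraMap K A u) := by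
    rw [map_sub, hw, hE.τ_algebraMap, hu, map_add, map_mul]
    ring
  have h2 := (isNilpotent_of_differentiallyAlgebraic hE ha ht h1 (hd.sub_algebraMap hE u)).eq_zero
  exact hwK ⟨u, (sub_eq_zero.mp h2).symm⟩

/-! ### From the logarithmic derivative back to the solution -/

theorem adjoin_range_bell :
    Algebra.adjoin K (Set.range D.bell) = (⊤ : Subalgebra K (MvPolynomial ℕ K)) := by
  set B := Algebra.adjoin K (Set.range D.bell)
  have hb : ∀ i, D.bell i ∈ B := fun i => Algebra.subset_adjoin ⟨i, rfl⟩
  have h0 : (X 0 : MvPolynomial ℕ K) ∈ B := bell_one D ▸ hb 1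
  have hdd : ∀ P ∈ B, D.dd P ∈ B := fun P hP => by
    induction hP using Algebra.adjoin_induction with
    | mem x hx =>
      obtain ⟨i, rfl⟩ := hx
      rw [← sub_eq_of_eq_add (bell_succ D i)]
      exact B.sub_mem (hb _) (B.mul_mem h0 (hb _))
    | algebraMap r =>
      rw [algebraMap_eq, dd_C]
      exact B.algebraMap_mem _
    | add x y _ _ hx hy =>
      rw [map_add]
      exact B.add_mem hx hy
    | mul x y hx' hy' hx hy =>
      rw [Derivation.leibniz]
      exact B.add_mem (B.mul_mem hx' hy) (B.mul_mem hy' hx)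
  have hX : ∀ i, (X i : MvPolynomial ℕ K) ∈ B := fun i => by
    induction i with
    | zero => exact h0
    | succ n ih => exact dd_X D n ▸ hdd _ ih
  rw [eq_top_iff, ← adjoin_range_X]
  exact Algebra.adjoin_le (by rintro _ ⟨i, rfl⟩; exact hX i)

/-- The `bell i` generate the ring, and since `bell 0 = 1`, multiplying by powers of `X 0` equalizes
degrees. -/
theorem exists_isHomogeneous_aeval_bell (Q : MvPolynomial ℕ K) :
    ∃ (n : ℕ) (P : MvPolynomial ℕ K), P.IsHomogeneous n ∧ aeval D.bell P = Q := by
  have hQ : Q ∈ Algebra.adjoin K (Set.range D.bell) := by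
    rw [adjoin_range_bell]
    exact Algebra.mem_top
  induction hQ using Algebra.adjoin_induction with
  | mem x hx =>
    obtain ⟨i, rfl⟩ := hx
    exact ⟨1, X i, isHomogeneous_X K i, aeval_X _ _⟩
  | algebraMap r => exact ⟨0, C r, isHomogeneous_C _ r, aeval_C _ _⟩
  | add x y _ _ hx hy =>
    obtain ⟨m, P, hP, rfl⟩ := hx
    obtain ⟨n, R, hR, rfl⟩ := hy
    refine ⟨n + m, X 0 ^ n * P + X 0 ^ m * R, ?_, ?_⟩
    · exact ((isHomogeneous_X_pow 0 n).mul hP).add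
        (add_comm m n ▸ (isHomogeneous_X_pow 0 m).mul hR)
    · simp [bell_zero]
  | mul x y _ _ hx hy =>
    obtain ⟨m, P, hP, rfl⟩ := hx
    obtain ⟨n, R, hR, rfl⟩ := hy
    exact ⟨m + n, P * R, hP.mul hR, map_mul _ _ _⟩

theorem iterate_eq_mul_evalDiff_bell (hE : D.Extends E) {z y : A} (hy : E.δ z = z * y) (i : ℕ) :
    E.δ^[i] z = z * E.evalDiff K y (D.bell i) := by
  induction i with
  | zero => simp [bell_zero]
  | succ n ih =>
    rw [Function.iterate_succ_apply', ih, Derivation.leibniz, hy, bell_succ, map_add, map_mul,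
      evalDiff_dd hE, evalDiff_X]
    simp only [smul_eq_mul, Function.iterate_zero, id_eq]
    ring

/-- Homogenizing `Q` to `P` gives `P (z, z', …) = z ^ n * Q (y, y', …)`. -/
theorem differentiallyAlgebraic_of_log (hE : D.Extends E) {z y : A} (hy : E.δ z = z * y)
    (hd : E.DifferentiallyAlgebraic K y) : E.DifferentiallyAlgebraic K z := by
  obtain ⟨Q, hQ, h⟩ := hd
  obtain ⟨n, P, hP, rfl⟩ := exists_isHomogeneous_aeval_bell (D := D) Q
  refine ⟨P, fun h0 => hQ (by rw [h0, map_zero]), ?_⟩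
  simp only [iterate_eq_mul_evalDiff_bell hE hy]
  rw [aeval_mul_of_isHomogeneous hP, ← comp_aeval_apply D.bell (E.evalDiff K y) P]
  exact (congrArg _ h).trans (mul_zero _)

/-- A telescoper yields a linear differential equation for the logarithmic derivative. -/
theorem differentiallyAlgebraic_of_hasTelescoper (hE : D.Extends E)
    (hc : ∀ x : A, E.τ x = x → ∃ c ∈ D.constants, algebraMap K A c = x) {b : K}
    (ht : D.HasTelescoper b) {y : A} (hy : E.τ y = y + algebraMap K A b) :
    E.DifferentiallyAlgebraic K y := by
  obtain ⟨n, α, g, ⟨j, hj⟩, hg⟩ := ht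
  let Q : MvPolynomial ℕ K := ∑ i : Fin (n + 1), C (α i : K) * X (i : ℕ) - C g
  have hα : ∀ i, D.τ (α i) = α i := fun i => (α i).2
  have hQ : D.shift 1 b Q = Q := by
    have hg' := congrArg (C : K → MvPolynomial ℕ K) hg
    simp only [map_sum, map_sub, map_mul] at hg'
    simp only [Q, map_sub, map_sum, map_mul, shift_C, hα, shift_one_X, mul_add,
      Finset.sum_add_distrib]
    rw [hg']
    ring
  -- `Q` is shift-invariant, so its value at `y` is `τ`-fixed, hence a constant; subtracting it
  -- leaves the coefficient `α j` of `X j` intact.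
  obtain ⟨c, -, hc⟩ := hc (E.evalDiff K y Q) (by
    rw [← evalDiff_shift hE (a := 1) (by simpa using hy), hQ])
  refine ⟨Q - C c, fun h0 => hj ?_, ?_⟩
  · have h1 := congrArg (coeff (Finsupp.single (j : ℕ) 1)) h0
    have h2 : (0 : ℕ →₀ ℕ) ≠ Finsupp.single (j : ℕ) 1 := fun h => by
      simpa using congrArg Finsupp.degree h
    have h3 : ∀ i : Fin (n + 1), (i : ℕ) = j ↔ i = j := fun i => Fin.ext_iff.symm
    simp only [Q, coeff_sub, coeff_sum, coeff_C_mul, coeff_X, coeff_C, if_neg h2,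
      Finsupp.single_left_inj one_ne_zero, h3, mul_ite, mul_one, mul_zero, Finset.sum_ite_eq',
      Finset.mem_univ, if_true, sub_zero, coeff_zero] at h1
    exact Subtype.ext h1
  · change E.evalDiff K y (Q - C c) = 0
    rw [map_sub, ← hc, evalDiff_C, sub_self]

theorem IsSolutionAlgebra.differentiallyAlgebraic_iff [CharZero K] (h : D.IsSolutionAlgebra E)
    {a : K} (ha : a ≠ 0) {z : A} (hz : IsUnit z) (hzτ : E.τ z = algebraMap K A a * z) :
    E.DifferentiallyAlgebraic K z ↔ D.HasTelescoper (D.δ a / a) := by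
  have := h.nontrivial
  refine ⟨fun hd => ?_, fun ht => ?_⟩
  · by_contra ht
    obtain ⟨n, hn⟩ := isNilpotent_of_differentiallyAlgebraic h.ext ha ht hzτ hd
    exact not_isUnit_zero (hn ▸ hz.pow n)
  · obtain ⟨y, hy⟩ : ∃ y, E.δ z = z * y := hz.dvd
    refine differentiallyAlgebraic_of_log h.ext hy (differentiallyAlgebraic_of_hasTelescoper h.ext
      (fun x => (h.constants_eq x).mp) ht ?_)
    -- Differentiating `τ z = a z` gives `τ y = y + δ a / a` after cancelling the unit `a z`.
    have haz : IsUnit (algebraMap K A a * z) := (ha.isUnit.map _).mul hz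
    refine haz.mul_left_cancel ?_
    have h1 := congrArg E.τ hy
    rw [map_mul, ← E.comm, hzτ, Derivation.leibniz, h.ext.δ_algebraMap, hy] at h1
    rw [← h1, div_eq_mul_inv, map_mul]
    have h2 : algebraMap K A a * algebraMap K A a⁻¹ = 1 := by
      rw [← map_mul, mul_inv_cancel₀ ha, map_one]
    simp only [smul_eq_mul]
    linear_combination (-(z * algebraMap K A (D.δ a))) * h2

end

end DiffDiffStructure

theorem mainTheorem3
    {K : Type*} [Field K] [CharZero K] (D : DiffDiffStructure K)
    (hτ : Function.Bijective D.τ) (hC : IsAlgClosed D.constants)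
    (a f : K) (ha0 : a ≠ 0) (ha1 : a ≠ 1) (hf : f ≠ 0)
    {F : Type*} [Field F] [Algebra K F] (E : DiffDiffStructure F) (hE : D.Extends E)
    (w : F) (hwK : w ∉ Set.range (algebraMap K F))
    (hw : E.τ w = algebraMap K F a * w + algebraMap K F f) :
    (∀ {Fa : Type*} [CommRing Fa] [Algebra K Fa] (Ea : DiffDiffStructure Fa),
      D.IsSolutionAlgebra Ea →
      ∀ z : Fa, IsUnit z → Ea.τ z = algebraMap K Fa a * z →
        (Ea.DifferentiallyTranscendental K z → E.DifferentiallyTranscendental K w) ∧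
        (E.DifferentiallyAlgebraic K w → Ea.DifferentiallyAlgebraic K z) ∧
        (Ea.DifferentiallyTranscendental K z ↔ ¬ D.HasTelescoper (D.δ a / a))) ∧
    (¬ D.HasTelescoper (D.δ a / a) → E.DifferentiallyTranscendental K w) := by
  have hmain : ¬ D.HasTelescoper (D.δ a / a) → E.DifferentiallyTranscendental K w := fun ht =>
    DiffDiffStructure.not_differentiallyAlgebraic_of_not_hasTelescoper hE ha0 ht hwK hw
  refine ⟨fun Ea hEa z hz hzτ => ?_, hmain⟩
  have hiff := hEa.differentiallyAlgebraic_iff ha0 hz hzτ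
  exact ⟨fun h => hmain fun ht => h (hiff.mpr ht),
    fun h => hiff.mpr (not_not.mp fun ht => hmain ht h), not_congr hiff⟩
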